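/- There exist absolute constants $c_0,c_1>0$ such that the following holds for all integers $d,r\ge 1$, all reals $B,\gamma,D>0$ with $B/\gamma\ge D/8$, and all integers $T$ with \[ T\;\ge\; c_0\cdot\frac{B^2}{\gamma^2D^2}\cdot\frac{d}{d\wedge r} \] (for $r\le d$ this is the condition $T\ge c_0\frac{B^2}{\gamma^2D^2}\cdot\frac dr$): \[ \sup_{\mathcal X\in\mathbb X_2(D)}\mathcal E^*(\mathcal X,\mathcal O_{\rm sc},T,\mathcal W_{{\rm com},r})\;\ge\;\frac{c_1B^2}{\gamma T}\cdot\frac{d}{d\wedge r}. \] Here $d\wedge r=\min\{d,r\}$, and $\mathbb X_2(D)$ is the collection of all non-empty $\mathcal X\subseteq\mathbb R^d$ with $\|x-y\|_2\le D$ for all $x,y\in\mathcal X$. For a domain $\mathcal X$, $\mathcal O_{\rm sc}$ is the set of all pairs $(f,O)$ such that $f$ and $f-\frac\gamma2\|\cdot\|_2^2$ are convex on the (convex) domain $\mathcal X$, and $O$ is a stochastic first-order oracle which, queried at $x\in\mathcal X$, returns a fresh random vector $\hat g(x)\in\mathbb R^d$ with $\mathbb E[\hat g(x)\mid x]\in\partial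 f(x)$ (the set of subgradients of $f$ on $\mathcal X$ at $x$) and $\|\hat g(x)\|_2^2\le B^2$ almost surely. $\mathcal W_{{\rm com},r}$ is the set of all channels (Markov kernels) from $\mathbb R^d$ to $\{0,1\}^r$. In step $t=1,\dots,T$, the algorithm queries a point of $\mathcal X$, the oracle's answer is passed through a channel $W_t\in\mathcal W_{{\rm com},r}$, and the algorithm observes only the output $Y_t$ of the channel; the query and the channel $W_t$ may both depend on the previous outputs $Y_1,\dots,Y_{t-1}$ and on randomness independent of everything else. After the $T$ queries the algorithm outputs a point $x_T\in\mathcal X$ depending on $Y_1,\dots,Y_T$ and on this randomness. Finally, $\mathcal E^*(\mathcal X,\mathcal O_{\rm sc},T,\mathcal W_{{\rm com},r})$ is the infimum, over all such algorithms and adaptive channel selection strategies, of $\sup_{(f,O)\in\mathcal O_{\rm sc}}\mathbb E\big[f(x_T)-\inf_{x\in\mathcal X}f(x)\big]$. -/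

import Mathlib

open MeasureTheory ProbabilityTheory
open scoped ENNReal

namespace CommOpt

/-- The Euclidean space of dimension `d`, with its `ℓ₂` norm and Borel sigma-algebra. -/
abbrev E (d : ℕ) : Type := EuclideanSpace ℝ (Fin d)

/-- An `r`-bit message, an element of `{0,1}^r`. -/
abbrev Msg (r : ℕ) : Type := Fin r → Bool

/-- The non-empty subsets of `ℝ^d` of `ℓ₂`-diameter at most `D`. -/
def domains (d : ℕ) (D : ℝ) : Set (Set (E d)) :=
  {X | X.Nonempty ∧ ∀ x ∈ X, ∀ y ∈ X, ‖x - y‖ ≤ D}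

/-- The set of subgradients at `x` of a function `f` on the domain `X`. -/
def subdifferential {d : ℕ} (X : Set (E d)) (f : E d → ℝ) (x : E d) : Set (E d) :=
  {g | ∀ y ∈ X, f x + inner ℝ g (y - x) ≤ f y}

/-- A first-order oracle on `X`: queried at `x`, it returns a fresh random vector `ĝ(x)`
with law `O x`. -/
abbrev Oracle {d : ℕ} (X : Set (E d)) : Type := Kernel X (E d)

/-- The family of pairs (function, oracle) on the domain `X` for which the function is convex and
`γ`-strongly convex on `X` (that is, `f - (γ/2)‖·‖²` is convex on `X`), and the outputs of the
oracle are unbiased estimates of subgradients and are almost surely bounded by `B`.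
Only the values of `f` on `X` matter. -/
def strongConvexFamily {d : ℕ} (X : Set (E d)) (B γ : ℝ) : Set ((E d → ℝ) × Oracle X) :=
  {p | ConvexOn ℝ X p.1 ∧
    ConvexOn ℝ X (fun x => p.1 x - γ / 2 * ‖x‖ ^ 2) ∧
    IsMarkovKernel p.2 ∧
    (∀ x : X, (∫ g, g ∂(p.2 x)) ∈ subdifferential X p.1 x) ∧
    (∀ x : X, ∀ᵐ g ∂(p.2 x), ‖g‖ ^ 2 ≤ B ^ 2)}

/-- The `r`-bit communication-constrained channels: all channels from `ℝ^d` to `{0,1}^r`. -/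
def comChannels (d r : ℕ) : Set (Kernel (E d) (Msg r)) :=
  {W | IsMarkovKernel W}

/-- A (possibly randomized) first-order algorithm on `X` with internal randomness in `Ω`. After
`t` messages have been received, the current iterate is a point of `X` which depends on the
randomness and on these messages. The iterates number `0, …, T - 1` are the `T` queries, and the
iterate number `T`, which depends on all `T` messages, is the output. -/
structure Algorithm (Ω : Type) [MeasurableSpace Ω] {d : ℕ} (X : Set (E d)) (r : ℕ) where
  iterate : (t : ℕ) → Ω → (Fin t → Msg r) → X
  measurable_iterate : ∀ t, Measurable (fun p : Ω × (Fin t → Msg r) => iterate t p.1 p.2)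

/-- An adaptive channel selection strategy: the channel used after `t` messages have been received
is an arbitrary member of the family `𝒲` that depends on these messages
(and on the randomness shared with the algorithm). -/
structure ChannelStrategy (Ω : Type) [MeasurableSpace Ω] {d r : ℕ}
    (𝒲 : Set (Kernel (E d) (Msg r))) where
  channel : (t : ℕ) → Ω → (Fin t → Msg r) → Kernel (E d) (Msg r)
  channel_mem : ∀ t u h, channel t u h ∈ 𝒲
  measurable_channel : ∀ t, Measurable
    (fun p : (Ω × (Fin t → Msg r)) × E d => channel t p.1.1 p.1.2 p.2)

section Run

variable {Ω : Type} [MeasurableSpace Ω] {d r : ℕ} {X : Set (E d)}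
  {𝒲 : Set (Kernel (E d) (Msg r))}

/-- The law of the first `t` messages, given the value `u` of the internal randomness. Given the
first `t` messages `h`, the point `iterate t u h` is queried, the oracle answers with a random
vector, this vector is sent through the channel `channel t u h`, and the output of the channel is
appended to `h` as the next message. -/
noncomputable def transcript (O : Oracle X) (π : Algorithm Ω X r) (S : ChannelStrategy Ω 𝒲)
    (u : Ω) : (t : ℕ) → Measure (Fin t → Msg r)
  | 0 => Measure.dirac Fin.elim0
  | t + 1 => (transcript O π S u t).bind fun h =>
      ((O (π.iterate t u h)).bind (S.channel t u h)).map
        fun y => (Fin.snoc h y : Fin (t + 1) → Msg r)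

/-- The expected optimization error `𝔼[f(x_T) - inf_X f]` after `T` queries, for internal
randomness with law `P`. -/
noncomputable def optError (P : Measure Ω) (f : E d → ℝ) (O : Oracle X)
    (π : Algorithm Ω X r) (S : ChannelStrategy Ω 𝒲) (T : ℕ) : ℝ≥0∞ :=
  ∫⁻ u, ∫⁻ h, ENNReal.ofReal (f (π.iterate T u h) - sInf (f '' X)) ∂(transcript O π S u T) ∂P

end Run

/-- The adaptive minmax optimization error: the infimum over all algorithms with `T` queries and
all adaptive channel selection strategies from `𝒲`, of the supremum of the expected optimization
error over the family `𝒪` of functions and oracles. -/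
noncomputable def minmaxError {d r : ℕ} (X : Set (E d)) (𝒪 : Set ((E d → ℝ) × Oracle X)) (T : ℕ)
    (𝒲 : Set (Kernel (E d) (Msg r))) : ℝ≥0∞ :=
  ⨅ (Ω : Type) (_ : MeasurableSpace Ω) (P : ProbabilityMeasure Ω)
    (π : Algorithm Ω X r) (S : ChannelStrategy Ω 𝒲),
    ⨆ p ∈ 𝒪, optError (P : Measure Ω) p.1 p.2 π S T

end CommOpt

/-! The hard objectives are quadratics `γ/2 ‖x - δ v‖²` indexed by sign vectors `v`, on a ball whose
radius shrinks like `T^(-1/2)`. To the query `x` the oracle answers `γ x - c z`, where `z` has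
independent signs with means `ε v i` and `c ε = γ δ`. The query is determined by the history and the
internal randomness, so a message can inform about `v` only through `z`. Each coordinate of the
output with the wrong sign costs `γ δ² / 2`, and optimizing becomes guessing the bits of `v`.

Three estimates carry the proof. A level-one inequality (`level_one`) combined with the entropy
bound for `r` bits shows that one message separates `v` from its `d` neighbours by a total squared
Hellinger distance of at most `16 ε² min(d, r)`. This quantity, averaged over `v`, is subadditive in
the number of messages, even for adaptive protocols (`IsTranscriptLaw.sum_one_sub_affinity_le`).
Assouad's argument then forces `d/6` wrong bits on average as long as the total is at most `d/4`
(`IsTranscriptLaw.sum_errors_ge`). The bound holds for each value of the internal randomness;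
integrating it and bounding the average over `v` by the supremum gives the result. -/

namespace CommOpt

/-! ### Biased product signs and the level-one inequality -/

/-- The sign `±1` of a bit. -/
def sgn (b : Bool) : ℝ := if b then 1 else -1

lemma sgn_mul_sgn_cases (a b : Bool) : sgn a * sgn b = 1 ∨ sgn a * sgn b = -1 := by
  cases a <;> cases b <;> simp [sgn]

lemma sgn_not (a : Bool) : sgn (!a) = -sgn a := by cases a <;> simp [sgn]

/-- The bit string obtained by flipping the bit number `i`. -/
def flipAt {d : ℕ} (i : Fin d) (v : Fin d → Bool) : Fin d → Bool := Function.update v i (!v i)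

lemma flipAt_flipAt {d : ℕ} (i : Fin d) (v : Fin d → Bool) : flipAt i (flipAt i v) = v := by
  ext j
  by_cases h : j = i
  · subst h; simp [flipAt]
  · simp [flipAt, h]

/-- Flipping a fixed bit, as a permutation. -/
def flipEquiv {d : ℕ} (i : Fin d) : Equiv.Perm (Fin d → Bool) :=
  ⟨flipAt i, flipAt i, flipAt_flipAt i, flipAt_flipAt i⟩

/-- The weight of one bit of a sign with mean `ε` times the sign of `a`. -/
noncomputable def bernBit (ε : ℝ) (a b : Bool) : ℝ := (1 + ε * (sgn a * sgn b)) / 2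

/-- The weight of `z` under the product distribution whose sign number `i` has mean
`ε * sgn (v i)`. -/
noncomputable def bern {d : ℕ} (ε : ℝ) (v z : Fin d → Bool) : ℝ := ∏ i, bernBit ε (v i) (z i)

/-- The normalized likelihood-ratio increment when the sign `a` is flipped. -/
noncomputable def score (ε : ℝ) (a b : Bool) : ℝ := sgn a * sgn b / (1 + ε * (sgn a * sgn b))

section Bernoulli

variable {ε : ℝ}

lemma bernBit_pos (h0 : 0 ≤ ε) (h1 : ε ≤ 1 / 2) (a b : Bool) : 0 < bernBit ε a b := by
  unfold bernBit
  rcases sgn_mul_sgn_cases a b with h | h <;> rw [h] <;> linarith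

lemma bernBit_sum (a : Bool) : ∑ b, bernBit ε a b = 1 := by
  cases a <;> simp [bernBit, sgn] <;> ring

lemma bernBit_sum_sgn (a : Bool) : ∑ b, bernBit ε a b * sgn b = ε * sgn a := by
  cases a <;> simp [bernBit, sgn] <;> ring

/-- With `s = ±1` the product of the two signs, the likelihood ratio is `(1 - ε s) / (1 + ε s)`,
which is affine in the score. Differences between neighbouring hypotheses thus become exact
correlations with the score. -/
lemma bernBit_not (h0 : 0 ≤ ε) (h1 : ε ≤ 1 / 2) (a b : Bool) :
    bernBit ε (!a) b = bernBit ε a b * (1 - 2 * ε * score ε a b) := by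
  unfold bernBit score
  rw [sgn_not, neg_mul]
  rcases sgn_mul_sgn_cases a b with h | h <;> rw [h]
  · have : 1 + ε * 1 ≠ 0 := by linarith
    field_simp
    ring
  · have : 1 - ε ≠ 0 := by linarith
    rw [show 1 + ε * -1 = 1 - ε by ring]
    field_simp
    ring

lemma bernBit_sum_score (h0 : 0 ≤ ε) (h1 : ε ≤ 1 / 2) (a : Bool) :
    ∑ b, bernBit ε a b * score ε a b = 0 := by
  have h : ∀ b, bernBit ε a b * score ε a b = sgn a * sgn b / 2 := by
    intro b
    unfold bernBit score
    have : 1 + ε * (sgn a * sgn b) ≠ 0 := by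
      rcases sgn_mul_sgn_cases a b with h | h <;> rw [h] <;> linarith
    rw [div_mul_div_comm, mul_comm, mul_div_mul_right _ _ this]
  simp only [h]
  cases a <;> norm_num [sgn]

lemma abs_score_le (h0 : 0 ≤ ε) (h1 : ε ≤ 1 / 2) (a b : Bool) : |score ε a b| ≤ 2 := by
  unfold score
  rcases sgn_mul_sgn_cases a b with h | h <;> rw [h, abs_le]
  · constructor
    · have : 0 ≤ 1 / (1 + ε * 1) := by positivity
      linarith
    · rw [div_le_iff₀ (by linarith)]; linarith
  · constructor
    · rw [le_div_iff₀ (by linarith)]; linarith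
    · rw [div_le_iff₀ (by linarith)]; linarith

/-- The chord of the convex exponential over `[-2l, 2l]`. The term linear in `x` vanishes once
averaged against a centred score, as in Hoeffding's lemma. -/
lemma exp_mul_le_of_abs_le_two (l x : ℝ) (hx : |x| ≤ 2) :
    Real.exp (l * x) ≤ Real.cosh (2 * l) + x / 2 * Real.sinh (2 * l) := by
  obtain ⟨h1, h2⟩ := abs_le.1 hx
  have h := convexOn_exp.2 (Set.mem_univ (2 * l)) (Set.mem_univ (-(2 * l)))
    (show 0 ≤ (1 + x / 2) / 2 by linarith) (show 0 ≤ (1 - x / 2) / 2 by linarith) (by ring)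
  simp only [smul_eq_mul] at h
  rw [Real.cosh_eq, Real.sinh_eq]
  calc Real.exp (l * x)
      = Real.exp ((1 + x / 2) / 2 * (2 * l) + (1 - x / 2) / 2 * -(2 * l)) := by congr 1; ring
    _ ≤ _ := h
    _ = _ := by ring

lemma bernBit_sum_exp_le (h0 : 0 ≤ ε) (h1 : ε ≤ 1 / 2) (a : Bool) (l : ℝ) :
    ∑ b, bernBit ε a b * Real.exp (l * score ε a b) ≤ Real.exp (2 * l ^ 2) := by
  calc ∑ b, bernBit ε a b * Real.exp (l * score ε a b)
      ≤ ∑ b, bernBit ε a b * (Real.cosh (2 * l) + score ε a b / 2 * Real.sinh (2 * l)) := by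
        refine Finset.sum_le_sum fun b _ => ?_
        exact mul_le_mul_of_nonneg_left
          (exp_mul_le_of_abs_le_two l _ (abs_score_le h0 h1 a b)) (bernBit_pos h0 h1 a b).le
    _ = (∑ b, bernBit ε a b) * Real.cosh (2 * l)
          + (∑ b, bernBit ε a b * score ε a b) * (Real.sinh (2 * l) / 2) := by
        rw [Finset.sum_mul, Finset.sum_mul, ← Finset.sum_add_distrib]
        exact Finset.sum_congr rfl fun b _ => by ring
    _ = Real.cosh (2 * l) := by rw [bernBit_sum, bernBit_sum_score h0 h1]; ring
    _ ≤ Real.exp ((2 * l) ^ 2 / 2) := Real.cosh_le_exp_half_sq _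
    _ = _ := by congr 1; ring

variable {d : ℕ}

lemma sum_prod_bits (g : Fin d → Bool → ℝ) :
    ∑ z : Fin d → Bool, ∏ i, g i (z i) = ∏ i, ∑ b, g i b := by
  rw [Finset.prod_univ_sum, Fintype.piFinset_univ]

lemma bern_pos (h0 : 0 ≤ ε) (h1 : ε ≤ 1 / 2) (v z : Fin d → Bool) : 0 < bern ε v z :=
  Finset.prod_pos fun _ _ => bernBit_pos h0 h1 _ _

lemma bern_sum (v : Fin d → Bool) : ∑ z, bern ε v z = 1 := by
  unfold bern
  rw [sum_prod_bits (fun i b => bernBit ε (v i) b)]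
  simp only [bernBit_sum, Finset.prod_const_one]

lemma bern_sum_coord (v : Fin d → Bool) (i : Fin d) (F : Bool → ℝ) :
    ∑ z, bern ε v z * F (z i) = ∑ b, bernBit ε (v i) b * F b := by
  have h : ∀ z : Fin d → Bool, bern ε v z * F (z i)
      = ∏ j, (bernBit ε (v j) (z j) * if j = i then F (z j) else 1) := by
    intro z
    rw [Finset.prod_mul_distrib, Finset.prod_ite_eq' Finset.univ i, if_pos (Finset.mem_univ _)]
    rfl
  simp only [h]
  rw [sum_prod_bits (fun j b => bernBit ε (v j) b * if j = i then F b else 1),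
    Finset.prod_eq_single i]
  · simp
  · intro j _ hj
    simp only [if_neg hj, mul_one, bernBit_sum]
  · simp

lemma bern_flipAt (h0 : 0 ≤ ε) (h1 : ε ≤ 1 / 2) (v z : Fin d → Bool) (i : Fin d) :
    bern ε (flipAt i v) z = bern ε v z * (1 - 2 * ε * score ε (v i) (z i)) := by
  unfold bern
  rw [← Finset.mul_prod_erase _ _ (Finset.mem_univ i),
    ← Finset.mul_prod_erase Finset.univ (fun j => bernBit ε (v j) (z j)) (Finset.mem_univ i)]
  have h : ∏ j ∈ Finset.univ.erase i, bernBit ε (flipAt i v j) (z j)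
      = ∏ j ∈ Finset.univ.erase i, bernBit ε (v j) (z j) := by
    refine Finset.prod_congr rfl fun j hj => ?_
    rw [flipAt, Function.update_of_ne (Finset.ne_of_mem_erase hj)]
  rw [h, flipAt, Function.update_self, bernBit_not h0 h1]
  ring

lemma bern_sum_exp_le (h0 : 0 ≤ ε) (h1 : ε ≤ 1 / 2) (v : Fin d → Bool) (l : Fin d → ℝ) :
    ∑ z, bern ε v z * Real.exp (∑ i, l i * score ε (v i) (z i))
      ≤ Real.exp (2 * ∑ i, l i ^ 2) := by
  have h : ∀ z : Fin d → Bool, bern ε v z * Real.exp (∑ i, l i * score ε (v i) (z i))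
      = ∏ i, (bernBit ε (v i) (z i) * Real.exp (l i * score ε (v i) (z i))) := by
    intro z
    rw [Finset.prod_mul_distrib, Real.exp_sum]
    rfl
  simp only [h]
  rw [sum_prod_bits (fun i b => bernBit ε (v i) b * Real.exp (l i * score ε (v i) b)),
    Finset.mul_sum, Real.exp_sum]
  refine Finset.prod_le_prod (fun i _ => ?_) fun i _ => bernBit_sum_exp_le h0 h1 _ _
  exact Finset.sum_nonneg fun b _ => mul_nonneg (bernBit_pos h0 h1 _ _).le (Real.exp_pos _).le

/-- Level-one inequality: a function with values in `[0, 1]` and small mean has small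
correlations with the scores. -/
lemma level_one (h0 : 0 ≤ ε) (h1 : ε ≤ 1 / 2) (v : Fin d → Bool) (W : (Fin d → Bool) → ℝ)
    (hW0 : ∀ z, 0 ≤ W z) (hW1 : ∀ z, W z ≤ 1) {μ : ℝ} (hμ : μ = ∑ z, bern ε v z * W z)
    (hpos : 0 < μ) :
    ∑ i, (∑ z, bern ε v z * W z * score ε (v i) (z i)) ^ 2 / μ ≤ 8 * (μ * Real.log (1 / μ)) := by
  -- `a i` is the conditional mean of score `i` under the law of `z` tilted by `W`.
  set a : Fin d → ℝ := fun i => (∑ z, bern ε v z * W z * score ε (v i) (z i)) / μ with ha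
  have hA : ∑ i, (∑ z, bern ε v z * W z * score ε (v i) (z i)) ^ 2 / μ = μ * ∑ i, a i ^ 2 := by
    rw [Finset.mul_sum]
    refine Finset.sum_congr rfl fun i _ => ?_
    simp only [ha]
    field_simp
  have hq0 : ∀ z, 0 ≤ bern ε v z * W z / μ := fun z =>
    div_nonneg (mul_nonneg (bern_pos h0 h1 v z).le (hW0 z)) hpos.le
  have hq1 : ∑ z, bern ε v z * W z / μ = 1 := by
    rw [← Finset.sum_div, ← hμ, div_self hpos.ne']
  -- Jensen under the tilted law. The coefficients `a i / 4` maximize `l * a i - 2 * l ^ 2`, the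
  -- gain minus the sub-Gaussian cost.
  have hJ := convexOn_exp.map_sum_le (t := Finset.univ)
    (w := fun z => bern ε v z * W z / μ)
    (p := fun z => ∑ i, (a i / 4) * score ε (v i) (z i))
    (fun z _ => hq0 z) hq1 (fun _ _ => Set.mem_univ _)
  simp only [smul_eq_mul] at hJ
  have hL : ∑ z, bern ε v z * W z / μ * ∑ i, (a i / 4) * score ε (v i) (z i)
      = (∑ i, a i ^ 2) / 4 := by
    simp only [Finset.mul_sum]
    rw [Finset.sum_comm, Finset.sum_div]
    refine Finset.sum_congr rfl fun i _ => ?_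
    have : a i ^ 2 / 4 = (a i / 4) * a i := by ring
    rw [this, show (a i / 4) * a i
      = a i / 4 * ((∑ z, bern ε v z * W z * score ε (v i) (z i)) / μ) from rfl,
      Finset.sum_div, Finset.mul_sum]
    exact Finset.sum_congr rfl fun z _ => by ring
  have hR : ∑ z, bern ε v z * W z / μ * Real.exp (∑ i, (a i / 4) * score ε (v i) (z i))
      ≤ 1 / μ * Real.exp ((∑ i, a i ^ 2) / 8) := by
    calc ∑ z, bern ε v z * W z / μ * Real.exp (∑ i, (a i / 4) * score ε (v i) (z i))
        ≤ ∑ z, 1 / μ * (bern ε v z * Real.exp (∑ i, (a i / 4) * score ε (v i) (z i))) := by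
          -- Since `W ≤ 1`, the tilted law is at most `1/μ` times the product law.
          refine Finset.sum_le_sum fun z _ => ?_
          have h := mul_le_mul_of_nonneg_left (hW1 z)
            (mul_nonneg (bern_pos h0 h1 v z).le
              (Real.exp_pos (∑ i, (a i / 4) * score ε (v i) (z i))).le)
          have h' := mul_le_mul_of_nonneg_left h (one_div_pos.2 hpos).le
          calc _ = 1 / μ * (bern ε v z * Real.exp (∑ i, (a i / 4) * score ε (v i) (z i)) * W z) := by
                ring
            _ ≤ _ := h'
            _ = _ := by ring
      _ ≤ 1 / μ * Real.exp (2 * ∑ i, (a i / 4) ^ 2) := by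
          rw [← Finset.mul_sum]
          exact mul_le_mul_of_nonneg_left (bern_sum_exp_le h0 h1 v _) (one_div_pos.2 hpos).le
      _ = _ := by
          congr 2
          simp only [div_pow]
          rw [← Finset.sum_div]
          ring
  rw [hL] at hJ
  have h := Real.log_le_log (Real.exp_pos _) (hJ.trans hR)
  rw [Real.log_mul (one_div_pos.2 hpos).ne' (Real.exp_pos _).ne', Real.log_exp, Real.log_exp] at h
  rw [hA]
  have : ∑ i, a i ^ 2 ≤ 8 * Real.log (1 / μ) := by linarith
  calc μ * ∑ i, a i ^ 2 ≤ μ * (8 * Real.log (1 / μ)) := mul_le_mul_of_nonneg_left this hpos.le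
    _ = _ := by ring

end Bernoulli

/-! ### Information carried by one message -/

section Channel

variable {d r : ℕ} {ε : ℝ}

/-- The law of the output of the channel `w` on a product Bernoulli input. -/
noncomputable def outLaw (ε : ℝ) (w : (Fin d → Bool) → Msg r → ℝ) (v : Fin d → Bool) (y : Msg r) : ℝ :=
  ∑ z, bern ε v z * w z y

lemma outLaw_nonneg (h0 : 0 ≤ ε) (h1 : ε ≤ 1 / 2) {w : (Fin d → Bool) → Msg r → ℝ}
    (hw : ∀ z y, 0 ≤ w z y) (v : Fin d → Bool) (y : Msg r) : 0 ≤ outLaw ε w v y :=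
  Finset.sum_nonneg fun z _ => mul_nonneg (bern_pos h0 h1 v z).le (hw z y)

lemma outLaw_sum {w : (Fin d → Bool) → Msg r → ℝ} (hw : ∀ z, ∑ y, w z y = 1)
    (v : Fin d → Bool) : ∑ y, outLaw ε w v y = 1 := by
  unfold outLaw
  rw [Finset.sum_comm]
  simp only [← Finset.mul_sum, hw, mul_one, bern_sum]

lemma outLaw_flipAt (h0 : 0 ≤ ε) (h1 : ε ≤ 1 / 2) (w : (Fin d → Bool) → Msg r → ℝ)
    (v : Fin d → Bool) (i : Fin d) (y : Msg r) :
    outLaw ε w (flipAt i v) y = outLaw ε w v y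
      - 2 * ε * ∑ z, bern ε v z * w z y * score ε (v i) (z i) := by
  unfold outLaw
  rw [Finset.mul_sum, ← Finset.sum_sub_distrib]
  refine Finset.sum_congr rfl fun z _ => ?_
  rw [bern_flipAt h0 h1]
  ring

/-- The left side is `(√p - √q)² / 2`, and `(p - q)² = (√p - √q)² (√p + √q)²` with `(√p + √q)² ≥ p`:
squared Hellinger distance is dominated by chi-square. -/
lemma half_add_sub_sqrt_le {p q : ℝ} (hp : 0 < p) (hq : 0 ≤ q) :
    (p + q) / 2 - √(p * q) ≤ (p - q) ^ 2 / p / 2 := by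
  rw [Real.sqrt_mul hp.le]
  obtain ⟨a, ha, rfl⟩ : ∃ a, 0 < a ∧ p = a ^ 2 := ⟨√p, Real.sqrt_pos.2 hp, (Real.sq_sqrt hp.le).symm⟩
  obtain ⟨b, hb, rfl⟩ : ∃ b, 0 ≤ b ∧ q = b ^ 2 := ⟨√q, Real.sqrt_nonneg _, (Real.sq_sqrt hq).symm⟩
  rw [Real.sqrt_sq ha.le, Real.sqrt_sq hb, div_div, le_div_iff₀ (by positivity)]
  have : 0 ≤ (a - b) ^ 2 * (2 * a * b + b ^ 2) := by positivity
  nlinarith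

lemma one_sub_affinity_le (h0 : 0 ≤ ε) (h1 : ε ≤ 1 / 2) {w : (Fin d → Bool) → Msg r → ℝ}
    (hw0 : ∀ z y, 0 ≤ w z y) (hw1 : ∀ z, ∑ y, w z y = 1) (v : Fin d → Bool) (i : Fin d) :
    1 - ∑ y, √(outLaw ε w v y * outLaw ε w (flipAt i v) y)
      ≤ 2 * ε ^ 2 * ∑ y, (∑ z, bern ε v z * w z y * score ε (v i) (z i)) ^ 2 / outLaw ε w v y := by
  have e : 1 - ∑ y, √(outLaw ε w v y * outLaw ε w (flipAt i v) y)
      = ∑ y, ((outLaw ε w v y + outLaw ε w (flipAt i v) y) / 2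
          - √(outLaw ε w v y * outLaw ε w (flipAt i v) y)) := by
    rw [Finset.sum_sub_distrib, ← Finset.sum_div, Finset.sum_add_distrib, outLaw_sum hw1,
      outLaw_sum hw1]
    norm_num
  rw [e, Finset.mul_sum]
  refine Finset.sum_le_sum fun y _ => ?_
  rcases (outLaw_nonneg h0 h1 hw0 v y).eq_or_lt with h | h
  -- All inputs have positive weight, so a message of probability zero under `v` is never sent under
  -- the neighbour either.
  · have hz : ∀ z, w z y = 0 := by
      intro z
      have := (Finset.sum_eq_zero_iff_of_nonneg
        (fun z _ => mul_nonneg (bern_pos h0 h1 v z).le (hw0 z y))).1 h.symm z (Finset.mem_univ _)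
      exact (mul_eq_zero.1 this).resolve_left (bern_pos h0 h1 v z).ne'
    simp [outLaw, hz]
  · refine (half_add_sub_sqrt_le h (outLaw_nonneg h0 h1 hw0 _ y)).trans (le_of_eq ?_)
    rw [outLaw_flipAt h0 h1]
    ring

/-- The entropy of `r` bits is at most `r log 2`, by comparison with the uniform law through `log x
≤ x - 1`. -/
lemma sum_mul_log_le {μ : Msg r → ℝ} (h0 : ∀ y, 0 ≤ μ y) (h1 : ∑ y, μ y = 1) :
    ∑ y, μ y * Real.log (1 / μ y) ≤ r := by
  have hN : (0 : ℝ) < 2 ^ r := by positivity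
  have hy : ∀ y, μ y * Real.log (1 / μ y) ≤ μ y * (r * Real.log 2) + (1 / 2 ^ r - μ y) := by
    intro y
    rcases (h0 y).eq_or_lt with h | h
    · rw [← h]; simp
    · have hl := Real.log_le_sub_one_of_pos (x := 1 / μ y / 2 ^ r) (by positivity)
      rw [Real.log_div (by positivity) hN.ne', Real.log_pow] at hl
      have := mul_le_mul_of_nonneg_left hl h.le
      have e : μ y * (1 / μ y / 2 ^ r - 1) = 1 / 2 ^ r - μ y := by field_simp
      rw [e] at this
      linarith
  refine (Finset.sum_le_sum fun y _ => hy y).trans ?_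
  rw [Finset.sum_add_distrib, ← Finset.sum_mul, Finset.sum_sub_distrib, h1]
  have : ∑ _y : Msg r, (1 : ℝ) / 2 ^ r = 1 := by simp
  rw [this]
  have h2 : Real.log 2 ≤ 1 := by linarith [Real.log_two_lt_d9]
  have : (r : ℝ) * Real.log 2 ≤ r * 1 := mul_le_mul_of_nonneg_left h2 (Nat.cast_nonneg _)
  linarith

lemma sum_score_sq_le_msg (h0 : 0 ≤ ε) (h1 : ε ≤ 1 / 2) {w : (Fin d → Bool) → Msg r → ℝ}
    (hw0 : ∀ z y, 0 ≤ w z y) (hw1 : ∀ z, ∑ y, w z y = 1) (v : Fin d → Bool) :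
    ∑ i, ∑ y, (∑ z, bern ε v z * w z y * score ε (v i) (z i)) ^ 2 / outLaw ε w v y ≤ 8 * r := by
  rw [Finset.sum_comm]
  calc _ ≤ ∑ y, 8 * (outLaw ε w v y * Real.log (1 / outLaw ε w v y)) := by
        refine Finset.sum_le_sum fun y _ => ?_
        rcases (outLaw_nonneg h0 h1 hw0 v y).eq_or_lt with h | h
        · simp [← h]
        · refine level_one h0 h1 v (fun z => w z y) (fun z => hw0 z y) (fun z => ?_) rfl h
          rw [← hw1 z]
          exact Finset.single_le_sum (fun y _ => hw0 z y) (Finset.mem_univ y)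
    _ ≤ 8 * r := by
        rw [← Finset.mul_sum]
        exact mul_le_mul_of_nonneg_left
          (sum_mul_log_le (outLaw_nonneg h0 h1 hw0 v) (outLaw_sum hw1 v)) (by norm_num)

/-- Scores are bounded by `2`, so each coordinate contributes at most `4`, whatever the channel. The
constant is relaxed to `8` to match `sum_score_sq_le_msg`. -/
lemma sum_score_sq_le_dim (h0 : 0 ≤ ε) (h1 : ε ≤ 1 / 2) {w : (Fin d → Bool) → Msg r → ℝ}
    (hw0 : ∀ z y, 0 ≤ w z y) (hw1 : ∀ z, ∑ y, w z y = 1) (v : Fin d → Bool) :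
    ∑ i, ∑ y, (∑ z, bern ε v z * w z y * score ε (v i) (z i)) ^ 2 / outLaw ε w v y ≤ 8 * d := by
  have hi : ∀ i, ∑ y, (∑ z, bern ε v z * w z y * score ε (v i) (z i)) ^ 2 / outLaw ε w v y
      ≤ 4 := by
    intro i
    calc _ ≤ ∑ y, 4 * outLaw ε w v y := by
          refine Finset.sum_le_sum fun y _ => ?_
          have hp := outLaw_nonneg h0 h1 hw0 v y
          have habs : |∑ z, bern ε v z * w z y * score ε (v i) (z i)| ≤ 2 * outLaw ε w v y := by
            refine (Finset.abs_sum_le_sum_abs _ _).trans ?_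
            rw [outLaw, Finset.mul_sum]
            refine Finset.sum_le_sum fun z _ => ?_
            have hn := mul_nonneg (bern_pos h0 h1 v z).le (hw0 z y)
            rw [abs_mul, abs_of_nonneg hn, mul_comm]
            exact mul_le_mul_of_nonneg_right (abs_score_le h0 h1 _ _) hn
          refine div_le_of_le_mul₀ hp (by positivity) ?_
          rw [← sq_abs]
          nlinarith [abs_nonneg (∑ z, bern ε v z * w z y * score ε (v i) (z i))]
      _ = 4 := by rw [← Finset.mul_sum, outLaw_sum hw1, mul_one]
  refine (Finset.sum_le_sum fun i _ => hi i).trans ?_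
  simp
  linarith [(Nat.cast_nonneg d : (0 : ℝ) ≤ d)]

/-- One message of `r` bits carries little information on the average coordinate. -/
lemma sum_one_sub_affinity_le (h0 : 0 ≤ ε) (h1 : ε ≤ 1 / 2) {w : (Fin d → Bool) → Msg r → ℝ}
    (hw0 : ∀ z y, 0 ≤ w z y) (hw1 : ∀ z, ∑ y, w z y = 1) (v : Fin d → Bool) :
    ∑ i, (1 - ∑ y, √(outLaw ε w v y * outLaw ε w (flipAt i v) y))
      ≤ 16 * ε ^ 2 * min (d : ℝ) r := by
  refine (Finset.sum_le_sum fun i _ => one_sub_affinity_le h0 h1 hw0 hw1 v i).trans ?_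
  rw [← Finset.mul_sum]
  have h : ∑ i, ∑ y, (∑ z, bern ε v z * w z y * score ε (v i) (z i)) ^ 2 / outLaw ε w v y
      ≤ 8 * min (d : ℝ) r := by
    rcases le_total (d : ℝ) r with h | h
    · rw [min_eq_left h]; exact sum_score_sq_le_dim h0 h1 hw0 hw1 v
    · rw [min_eq_right h]; exact sum_score_sq_le_msg h0 h1 hw0 hw1 v
  calc _ ≤ 2 * ε ^ 2 * (8 * min (d : ℝ) r) := mul_le_mul_of_nonneg_left h (by positivity)
    _ = _ := by ring

end Channel

end CommOpt

namespace CommOpt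

/-! ### Adaptive protocols: Hellinger subadditivity and Assouad's lemma -/

section Chain

variable {d : ℕ} {M : Type*} [Fintype M]

lemma sum_snoc {t : ℕ} (F : (Fin (t + 1) → M) → ℝ) :
    ∑ h, F h = ∑ h : Fin t → M, ∑ y, F (Fin.snoc h y : Fin (t + 1) → M) := by
  rw [← (Fin.snocEquiv (fun _ : Fin (t + 1) => M)).sum_comp F, Fintype.sum_prod_type,
    Finset.sum_comm]
  rfl

/-- Weights of the transcripts of an adaptive protocol with transition weights `k`. -/
structure IsTranscriptLaw (k : (t : ℕ) → (Fin t → M) → (Fin d → Bool) → M → ℝ)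
    (Q : (Fin d → Bool) → (t : ℕ) → (Fin t → M) → ℝ) : Prop where
  zero : ∀ v h, Q v 0 h = 1
  succ : ∀ v t (h : Fin t → M) (y : M),
    Q v (t + 1) (Fin.snoc h y : Fin (t + 1) → M) = Q v t h * k t h v y
  nonneg : ∀ t h v y, 0 ≤ k t h v y
  sum_eq_one : ∀ t h v, ∑ y, k t h v y = 1

variable {k : (t : ℕ) → (Fin t → M) → (Fin d → Bool) → M → ℝ}
  {Q : (Fin d → Bool) → (t : ℕ) → (Fin t → M) → ℝ}

lemma IsTranscriptLaw.Q_nonneg (hQ : IsTranscriptLaw k Q) (v : Fin d → Bool) :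
    ∀ (t : ℕ) (h : Fin t → M), 0 ≤ Q v t h
  | 0, h => by rw [hQ.zero]; norm_num
  | t + 1, h => by
    rw [← Fin.snoc_init_self h, hQ.succ]
    exact mul_nonneg (hQ.Q_nonneg v t _) (hQ.nonneg _ _ _ _)

lemma IsTranscriptLaw.Q_sum (hQ : IsTranscriptLaw k Q) (v : Fin d → Bool) :
    ∀ t : ℕ, ∑ h, Q v t h = 1
  | 0 => by simp [hQ.zero]
  | t + 1 => by
    rw [sum_snoc]
    simp only [hQ.succ, ← Finset.mul_sum, hQ.sum_eq_one, mul_one]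
    exact hQ.Q_sum v t

lemma sqrt_mul_le_half_add {a b : ℝ} (ha : 0 ≤ a) (hb : 0 ≤ b) : √(a * b) ≤ (a + b) / 2 := by
  rw [Real.sqrt_le_left (by positivity)]
  nlinarith [sq_nonneg (a - b)]

lemma affinity_le_one {a b : M → ℝ} (ha : ∀ y, 0 ≤ a y) (hb : ∀ y, 0 ≤ b y)
    (ha1 : ∑ y, a y = 1) (hb1 : ∑ y, b y = 1) : ∑ y, √(a y * b y) ≤ 1 := by
  refine (Finset.sum_le_sum fun y _ => sqrt_mul_le_half_add (ha y) (hb y)).trans ?_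
  rw [← Finset.sum_div, Finset.sum_add_distrib, ha1, hb1]
  norm_num

/-- Subadditivity along the protocol of the average squared Hellinger distance between
neighbouring hypotheses. -/
lemma IsTranscriptLaw.sum_one_sub_affinity_le (hQ : IsTranscriptLaw k Q) {η : ℝ}
    (hη : ∀ t h v, ∑ i, (1 - ∑ y, √(k t h v y * k t h (flipAt i v) y)) ≤ η) :
    ∀ t : ℕ, ∑ v, ∑ i, (1 - ∑ h, √(Q v t h * Q (flipAt i v) t h)) ≤ 2 ^ d * (t * η)
  | 0 => by simp [hQ.zero]
  | t + 1 => by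
    have ih := hQ.sum_one_sub_affinity_le hη t
    set H : (Fin t → M) → (Fin d → Bool) → Fin d → ℝ := fun h v i =>
      1 - ∑ y, √(k t h v y * k t h (flipAt i v) y) with hH
    have hH0 : ∀ h v i, 0 ≤ H h v i := fun h v i =>
      sub_nonneg.2 (affinity_le_one (hQ.nonneg t h v) (hQ.nonneg t h _) (hQ.sum_eq_one t h v)
        (hQ.sum_eq_one t h _))
    have hHs : ∀ h v i, H h (flipAt i v) i = H h v i := by
      intro h v i
      simp only [hH, flipAt_flipAt]
      congr 1
      exact Finset.sum_congr rfl fun y _ => by rw [mul_comm]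
    have hstep : ∀ v i, 1 - ∑ h, √(Q v (t + 1) h * Q (flipAt i v) (t + 1) h)
        ≤ (1 - ∑ h, √(Q v t h * Q (flipAt i v) t h))
          + ((∑ h, Q v t h * H h v i) / 2 + (∑ h, Q (flipAt i v) t h * H h v i) / 2) := by
      intro v i
      have e : ∑ h, √(Q v (t + 1) h * Q (flipAt i v) (t + 1) h)
          = ∑ h, √(Q v t h * Q (flipAt i v) t h) * (1 - H h v i) := by
        rw [sum_snoc]
        refine Finset.sum_congr rfl fun h _ => ?_
        simp only [hH, sub_sub_cancel, Finset.mul_sum]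
        refine Finset.sum_congr rfl fun y _ => ?_
        rw [hQ.succ, hQ.succ, mul_mul_mul_comm,
          Real.sqrt_mul (mul_nonneg (hQ.Q_nonneg _ _ _) (hQ.Q_nonneg _ _ _))]
      -- The weight `√(Q v * Q (flipAt i v))` depends on `i`, whereas `hη` controls a sum over `i`
      -- at fixed `v` and `h`. The arithmetic-geometric mean inequality splits it into two
      -- transcript laws.
      have b : ∑ h, √(Q v t h * Q (flipAt i v) t h) * H h v i
          ≤ (∑ h, Q v t h * H h v i) / 2 + (∑ h, Q (flipAt i v) t h * H h v i) / 2 := by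
        rw [Finset.sum_div, Finset.sum_div, ← Finset.sum_add_distrib]
        refine Finset.sum_le_sum fun h _ => ?_
        refine (mul_le_mul_of_nonneg_right
          (sqrt_mul_le_half_add (hQ.Q_nonneg v t h) (hQ.Q_nonneg _ t h)) (hH0 h v i)).trans
          (le_of_eq (by ring))
      rw [e]
      simp only [mul_sub, mul_one, Finset.sum_sub_distrib]
      linarith
    -- `H` is symmetric under the flip, so reindexing `v` turns the second half into the first. This
    -- is why the estimate is averaged over `v`.
    have hsym : ∑ v, ∑ i, ∑ h, Q (flipAt i v) t h * H h v i
        = ∑ v, ∑ i, ∑ h, Q v t h * H h v i := by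
      rw [Finset.sum_comm, Finset.sum_comm (f := fun v i => ∑ h, Q v t h * H h v i)]
      refine Finset.sum_congr rfl fun i _ => ?_
      rw [← Equiv.sum_comp (flipEquiv i) (fun v => ∑ h, Q v t h * H h v i)]
      refine Finset.sum_congr rfl fun v _ => Finset.sum_congr rfl fun h _ => ?_
      change _ = Q (flipAt i v) t h * H h (flipAt i v) i
      rw [hHs]
    have hb : ∑ v, ∑ i, ∑ h, Q v t h * H h v i ≤ 2 ^ d * η := by
      calc _ ≤ ∑ _v : Fin d → Bool, η := by
            refine Finset.sum_le_sum fun v _ => ?_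
            rw [Finset.sum_comm]
            calc _ ≤ ∑ h, Q v t h * η := by
                  refine Finset.sum_le_sum fun h _ => ?_
                  rw [← Finset.mul_sum]
                  exact mul_le_mul_of_nonneg_left (hη t h v) (hQ.Q_nonneg v t h)
              _ = η := by rw [← Finset.sum_mul, hQ.Q_sum, one_mul]
        _ = 2 ^ d * η := by simp
    calc _ ≤ ∑ v, ∑ i, ((1 - ∑ h, √(Q v t h * Q (flipAt i v) t h))
          + ((∑ h, Q v t h * H h v i) / 2 + (∑ h, Q (flipAt i v) t h * H h v i) / 2)) :=
          Finset.sum_le_sum fun v _ => Finset.sum_le_sum fun i _ => hstep v i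
      _ = ∑ v, ∑ i, (1 - ∑ h, √(Q v t h * Q (flipAt i v) t h))
          + ((∑ v, ∑ i, ∑ h, Q v t h * H h v i) / 2
            + (∑ v, ∑ i, ∑ h, Q (flipAt i v) t h * H h v i) / 2) := by
          simp only [Finset.sum_add_distrib, Finset.sum_div]
      _ ≤ _ := by
          rw [hsym]
          push_cast
          linarith

/-- If `p ≤ q`, the right side is `p + q / 4`, and this is the arithmetic-geometric mean inequality
for `p` and `q / 4`. -/
lemma sqrt_mul_le_min {p q : ℝ} (hp : 0 ≤ p) (hq : 0 ≤ q) :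
    √(p * q) ≤ 3 / 4 * min p q + (p + q) / 4 := by
  rw [Real.sqrt_le_left (by positivity)]
  rcases le_total p q with h | h
  · rw [min_eq_left h]; nlinarith [sq_nonneg (p - q / 4)]
  · rw [min_eq_right h]; nlinarith [sq_nonneg (q - p / 4)]

/-- Assouad's lemma for adaptive protocols. -/
lemma IsTranscriptLaw.sum_errors_ge (hQ : IsTranscriptLaw k Q) {η : ℝ}
    (hη : ∀ t h v, ∑ i, (1 - ∑ y, √(k t h v y * k t h (flipAt i v) y)) ≤ η)
    {T : ℕ} (hT : T * η ≤ d / 4) (s : (Fin T → M) → Fin d → Bool) :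
    2 ^ d * (d / 6 : ℝ) ≤ ∑ v, ∑ h, Q v T h * ∑ i, (if s h i = v i then (0 : ℝ) else 1) := by
  have hA := (hQ.sum_one_sub_affinity_le hη T).trans
    (mul_le_mul_of_nonneg_left hT (by positivity : (0 : ℝ) ≤ 2 ^ d))
  set R : (Fin d → Bool) → Fin d → ℝ := fun v i =>
    ∑ h, Q v T h * (if s h i = v i then (0 : ℝ) else 1) with hR
  have hsum : ∑ v, ∑ h, Q v T h * ∑ i, (if s h i = v i then (0 : ℝ) else 1)
      = ∑ v, ∑ i, R v i := by
    refine Finset.sum_congr rfl fun v _ => ?_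
    simp only [Finset.mul_sum, hR]
    exact Finset.sum_comm
  have hsym : ∑ v, ∑ i, R (flipAt i v) i = ∑ v, ∑ i, R v i := by
    rw [Finset.sum_comm, Finset.sum_comm (f := fun v i => R v i)]
    exact Finset.sum_congr rfl fun i _ => Equiv.sum_comp (flipEquiv i) (fun v => R v i)
  have hpt : ∀ v i, ∑ h, √(Q v T h * Q (flipAt i v) T h)
      ≤ 3 / 4 * (R v i + R (flipAt i v) i) + 1 / 2 := by
    intro v i
    calc _ ≤ ∑ h, (3 / 4 * (Q v T h * (if s h i = v i then (0 : ℝ) else 1)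
              + Q (flipAt i v) T h * (if s h i = flipAt i v i then (0 : ℝ) else 1))
            + (Q v T h + Q (flipAt i v) T h) / 4) := by
          refine Finset.sum_le_sum fun h _ => ?_
          refine (sqrt_mul_le_min (hQ.Q_nonneg v T h) (hQ.Q_nonneg _ T h)).trans ?_
          have hf : flipAt i v i = !v i := by simp [flipAt]
          have h1 := min_le_left (Q v T h) (Q (flipAt i v) T h)
          have h2 := min_le_right (Q v T h) (Q (flipAt i v) T h)
          -- The guess is wrong for exactly one of the two neighbours, and the mass charged there is
          -- at least the minimum.
          by_cases hs : s h i = v i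
          · have : ¬ s h i = flipAt i v i := by rw [hf, hs]; simp
            rw [if_pos hs, if_neg this]
            linarith
          · have : s h i = flipAt i v i := by rw [hf]; exact Bool.eq_not.2 hs
            rw [if_neg hs, if_pos this]
            linarith
      _ = _ := by
          rw [Finset.sum_add_distrib, ← Finset.mul_sum, ← Finset.sum_div, Finset.sum_add_distrib,
            Finset.sum_add_distrib, hQ.Q_sum, hQ.Q_sum]
          norm_num [hR]
  have htot : ∑ v : Fin d → Bool, ∑ i, (1 - ∑ h, √(Q v T h * Q (flipAt i v) T h))
      ≥ ∑ v : Fin d → Bool, ∑ i : Fin d, (1 / 2 - 3 / 4 * (R v i + R (flipAt i v) i)) :=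
    Finset.sum_le_sum fun v _ => Finset.sum_le_sum fun i _ => by linarith [hpt v i]
  have hval : ∑ v : Fin d → Bool, ∑ i : Fin d, (1 / 2 - 3 / 4 * (R v i + R (flipAt i v) i))
      = 2 ^ d * (d / 2) - 3 / 4 * (2 * ∑ v, ∑ i, R v i) := by
    simp only [Finset.sum_sub_distrib, ← Finset.mul_sum, Finset.sum_add_distrib, hsym]
    simp
    ring
  rw [hsum]
  rw [hval] at htot
  -- With `S` the total error: `2^d * d/2 - 3/2 * S ≤ 2^d * d/4`, hence `S ≥ 2^d * d/6`.
  linarith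

end Chain

end CommOpt

namespace CommOpt

/-! ### Hard instances: quadratics with sign-noise oracles -/

variable {d r : ℕ}

/-- The vector of signs of a bit string. -/
noncomputable def signVec (z : Fin d → Bool) : E d := WithLp.toLp 2 fun i => sgn (z i)

lemma sgn_sq (b : Bool) : sgn b ^ 2 = 1 := by cases b <;> simp [sgn]

lemma norm_sq_signVec (z : Fin d → Bool) : ‖signVec z‖ ^ 2 = d := by
  rw [EuclideanSpace.real_norm_sq_eq]
  simp [signVec, sgn_sq]

lemma norm_signVec (z : Fin d → Bool) : ‖signVec z‖ = √(d : ℝ) := by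
  rw [← norm_sq_signVec z, Real.sqrt_sq (norm_nonneg _)]

lemma sum_bern_smul_signVec {ε : ℝ} (v : Fin d → Bool) :
    ∑ z, bern ε v z • signVec z = ε • signVec v := by
  ext i
  simp only [WithLp.ofLp_sum, Finset.sum_apply, PiLp.smul_apply, smul_eq_mul, signVec]
  rw [bern_sum_coord v i sgn, bernBit_sum_sgn]

/-- The oracle which answers `γ • x - c • z` to the query `x`, for a vector `z` of independent signs
with means `ε * sgn (v i)`. -/
noncomputable def bernOracle (X : Set (E d)) (γ c ε : ℝ) (v : Fin d → Bool) : Oracle X where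
  toFun x := ∑ z, ENNReal.ofReal (bern ε v z) • Measure.dirac (γ • (x : E d) - c • signVec z)
  measurable' := by
    refine Measure.measurable_of_measurable_coe _ fun s hs => ?_
    simp only [Measure.coe_finsetSum, Finset.sum_apply, Measure.smul_apply, smul_eq_mul]
    refine Finset.measurable_fun_sum _ fun z _ => Measurable.const_mul ?_ _
    refine (Measure.measurable_coe hs).comp (Measure.measurable_dirac.comp ?_)
    fun_prop

lemma bernOracle_apply (X : Set (E d)) (γ c ε : ℝ) (v : Fin d → Bool) (x : X) :
    bernOracle X γ c ε v x
      = ∑ z, ENNReal.ofReal (bern ε v z) • Measure.dirac (γ • (x : E d) - c • signVec z) := rfl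

lemma bernOracle_bind_apply (X : Set (E d)) (γ c ε : ℝ) (v : Fin d → Bool) (x : X)
    (W : Kernel (E d) (Msg r)) (y : Msg r) :
    ((bernOracle X γ c ε v x).bind W) {y}
      = ∑ z, ENNReal.ofReal (bern ε v z) * W (γ • (x : E d) - c • signVec z) {y} := by
  rw [Measure.bind_apply (measurableSet_singleton y) W.aemeasurable, bernOracle_apply,
    lintegral_finsetSum_measure]
  simp only [lintegral_smul_measure, smul_eq_mul, lintegral_dirac]

lemma bernOracle_isMarkovKernel (X : Set (E d)) (γ c : ℝ) {ε : ℝ} (h0 : 0 ≤ ε) (h1 : ε ≤ 1 / 2)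
    (v : Fin d → Bool) : IsMarkovKernel (bernOracle X γ c ε v) := by
  refine ⟨fun x => ⟨?_⟩⟩
  rw [bernOracle_apply]
  simp only [Measure.coe_finsetSum, Finset.sum_apply, Measure.smul_apply, smul_eq_mul,
    measure_univ, mul_one]
  rw [← ENNReal.ofReal_sum_of_nonneg fun z _ => (bern_pos h0 h1 v z).le, bern_sum,
    ENNReal.ofReal_one]

lemma integral_bernOracle (X : Set (E d)) (γ c : ℝ) {ε : ℝ} (h0 : 0 ≤ ε) (h1 : ε ≤ 1 / 2)
    (v : Fin d → Bool) (x : X) :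
    ∫ g, g ∂(bernOracle X γ c ε v x) = γ • (x : E d) - (c * ε) • signVec v := by
  rw [bernOracle_apply, integral_finsetSum_measure]
  · simp only [integral_smul_measure, integral_dirac,
      ENNReal.toReal_ofReal (bern_pos h0 h1 v _).le, smul_sub, Finset.sum_sub_distrib]
    rw [← Finset.sum_smul, bern_sum, one_smul]
    simp only [smul_comm _ c (signVec _)]
    rw [← Finset.smul_sum, sum_bern_smul_signVec, smul_smul]
  · intro z _
    exact (integrable_dirac (by simp)).smul_measure ENNReal.ofReal_ne_top

lemma ae_bernOracle {X : Set (E d)} {γ c ε : ℝ} {v : Fin d → Bool} {x : X} {p : E d → Prop}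
    (hp : ∀ z, p (γ • (x : E d) - c • signVec z)) : ∀ᵐ g ∂(bernOracle X γ c ε v x), p g := by
  rw [bernOracle_apply, ae_iff]
  simp only [Measure.coe_finsetSum, Finset.sum_apply, Measure.smul_apply, smul_eq_mul]
  refine Finset.sum_eq_zero fun z _ => ?_
  rw [mul_eq_zero]
  right
  exact (ae_dirac_eq (γ • (x : E d) - c • signVec z) ▸ hp z :
    ∀ᵐ g ∂(Measure.dirac (γ • (x : E d) - c • signVec z)), p g)

/-- The quadratic function with minimizer `a`. -/
noncomputable def quad (γ : ℝ) (a x : E d) : ℝ := γ / 2 * ‖x - a‖ ^ 2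

lemma quad_mem_strongConvexFamily {B γ ρ ε δ c : ℝ} (hγ : 0 < γ) (h0 : 0 ≤ ε)
    (h1 : ε ≤ 1 / 2) (hc : 0 ≤ c) (hcε : c * ε = γ * δ) (hB : γ * ρ + c * √(d : ℝ) ≤ B)
    (v : Fin d → Bool) :
    (quad γ (δ • signVec v), bernOracle (Metric.closedBall 0 ρ) γ c ε v) ∈
      strongConvexFamily (Metric.closedBall (0 : E d) ρ) B γ := by
  set a : E d := δ • signVec v with ha
  have hX := convex_closedBall (0 : E d) ρ
  have hid : ∀ x y : E d, ‖y - a‖ ^ 2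
      = ‖x - a‖ ^ 2 + 2 * inner ℝ (x - a) (y - x) + ‖y - x‖ ^ 2 := by
    intro x y
    rw [← norm_add_sq_real]
    congr 2
    abel
  have hlin : ConvexOn ℝ (Metric.closedBall (0 : E d) ρ)
      (fun x => quad γ a x - γ / 2 * ‖x‖ ^ 2) := by
    have e : (fun x => quad γ a x - γ / 2 * ‖x‖ ^ 2)
        = fun x => (innerSL ℝ (-(γ • a))).toLinearMap x + γ / 2 * ‖a‖ ^ 2 := by
      funext x
      have := norm_sub_sq_real x a
      simp only [quad, this, ContinuousLinearMap.coe_coe, innerSL_apply_apply, inner_neg_left,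
        real_inner_smul_left, real_inner_comm x a]
      ring
    rw [e]
    exact (LinearMap.convexOn _ hX).add_const _
  refine ⟨?_, hlin, bernOracle_isMarkovKernel _ _ _ h0 h1 _, fun x => ?_, fun x => ?_⟩
  · have hsq : ConvexOn ℝ (Metric.closedBall (0 : E d) ρ) (fun x : E d => γ / 2 * ‖x‖ ^ 2) :=
      ((convexOn_norm hX).pow (fun x _ => norm_nonneg x) 2).smul (by positivity : 0 ≤ γ / 2)
    refine (hlin.add hsq).congr fun x _ => ?_
    simp
  · rw [integral_bernOracle _ _ _ h0 h1, hcε, mul_smul, ← ha, ← smul_sub]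
    intro y _
    simp only [quad, real_inner_smul_left]
    rw [hid x y]
    nlinarith [sq_nonneg ‖y - (x : E d)‖]
  · refine ae_bernOracle fun z => ?_
    have hx : ‖(x : E d)‖ ≤ ρ := mem_closedBall_zero_iff.1 x.2
    have : ‖γ • (x : E d) - c • signVec z‖ ≤ B := by
      refine (norm_sub_le _ _).trans (le_trans ?_ hB)
      rw [norm_smul, norm_smul, norm_signVec, Real.norm_of_nonneg hγ.le, Real.norm_of_nonneg hc]
      gcongr
    exact pow_le_pow_left₀ (norm_nonneg _) this 2

/-- The hypothesis `hδρ` puts the minimizer in the ball, so the infimum is at most `0`. A coordinate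
of `x` on the wrong side of `0` is at distance at least `δ` from `±δ`. -/
lemma quad_sub_sInf_ge {γ ρ δ : ℝ} (hγ : 0 < γ) (hδ : 0 ≤ δ)
    (hδρ : δ * √(d : ℝ) ≤ ρ) (v : Fin d → Bool) (x : E d) :
    γ / 2 * δ ^ 2 * ∑ i, (if decide (0 ≤ x i) = v i then (0 : ℝ) else 1)
      ≤ quad γ (δ • signVec v) x
        - sInf (quad γ (δ • signVec v) '' Metric.closedBall (0 : E d) ρ) := by
  have hinf : sInf (quad γ (δ • signVec v) '' Metric.closedBall (0 : E d) ρ) ≤ 0 := by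
    refine csInf_le ⟨0, ?_⟩ ⟨δ • signVec v, ?_, by simp [quad]⟩
    · rintro _ ⟨y, _, rfl⟩
      unfold quad
      positivity
    · rw [mem_closedBall_zero_iff, norm_smul, norm_signVec, Real.norm_of_nonneg hδ]
      exact hδρ
  refine le_trans ?_ (sub_le_sub_left hinf _)
  rw [sub_zero, quad, EuclideanSpace.real_norm_sq_eq, mul_assoc]
  refine mul_le_mul_of_nonneg_left ?_ (by positivity)
  rw [Finset.mul_sum]
  refine Finset.sum_le_sum fun i _ => ?_
  have hval : (x - δ • signVec v) i = x i - δ * sgn (v i) := by simp [signVec]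
  rw [hval]
  split_ifs with h
  · rw [mul_zero]; positivity
  · cases hv : v i
    · rw [hv] at h
      have : 0 ≤ x i := by simpa using h
      simp only [sgn]
      norm_num
      nlinarith
    · rw [hv] at h
      have : x i < 0 := by simpa using h
      simp only [sgn]
      norm_num
      nlinarith

/-! ### Transcripts as finite weights -/

section Run

variable {Ω : Type} [MeasurableSpace Ω] {X : Set (E d)} {𝒲 : Set (Kernel (E d) (Msg r))}

lemma transcript_succ_snoc (O : Oracle X) (π : Algorithm Ω X r) (S : ChannelStrategy Ω 𝒲)
    (u : Ω) (t : ℕ) (h : Fin t → Msg r) (y : Msg r) :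
    transcript O π S u (t + 1) {(Fin.snoc h y : Fin (t + 1) → Msg r)}
      = transcript O π S u t {h} * ((O (π.iterate t u h)).bind (S.channel t u h)) {y} := by
  rw [transcript, Measure.bind_apply (measurableSet_singleton _) (measurable_of_countable _).aemeasurable,
    lintegral_fintype, Finset.sum_eq_single h]
  · rw [Measure.map_apply (measurable_of_countable _) (measurableSet_singleton _), mul_comm]
    congr 2
    ext y'
    simp [Fin.snoc_inj]
  · intro h' _ hne
    rw [Measure.map_apply (measurable_of_countable _) (measurableSet_singleton _)]
    have : (fun y => (Fin.snoc h' y : Fin (t + 1) → Msg r)) ⁻¹'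
        {(Fin.snoc h y : Fin (t + 1) → Msg r)} = ∅ := by
      ext y'
      simp [Fin.snoc_inj, hne]
    rw [this, measure_empty, zero_mul]
  · simp

/-- Needed to exchange the sum over `v` with the integral over the internal randomness. -/
lemma measurable_transcript (γ c ε : ℝ) (v : Fin d → Bool) (π : Algorithm Ω X r)
    (S : ChannelStrategy Ω 𝒲) : ∀ (t : ℕ) (h : Fin t → Msg r),
      Measurable fun u => transcript (bernOracle X γ c ε v) π S u t {h}
  | 0, h => measurable_const
  | t + 1, h => by
    have e : ∀ u, transcript (bernOracle X γ c ε v) π S u (t + 1) {h}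
        = transcript (bernOracle X γ c ε v) π S u t {Fin.init h}
          * ∑ z, ENNReal.ofReal (bern ε v z) *
            S.channel t u (Fin.init h)
              (γ • (π.iterate t u (Fin.init h) : E d) - c • signVec z) {h (Fin.last t)} := by
      intro u
      rw [← bernOracle_bind_apply, ← transcript_succ_snoc, Fin.snoc_init_self]
    simp only [e]
    refine (measurable_transcript γ c ε v π S t _).mul ?_
    refine Finset.measurable_fun_sum _ fun z _ => Measurable.const_mul ?_ _
    have hit : Measurable fun u => (π.iterate t u (Fin.init h) : E d) :=
      measurable_subtype_coe.comp ((π.measurable_iterate t).comp measurable_prodMk_right)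
    exact (Measure.measurable_coe (measurableSet_singleton _)).comp
      ((S.measurable_channel t).comp
        ((measurable_prodMk_right (y := Fin.init h)).prodMk
          ((hit.const_smul γ).sub_const (c • signVec z))))

/-- Once `u` and `h` are fixed, the query is a known point, so oracle and channel together act as a
finite channel with input `z`, to which the one-message bound applies. -/
lemma isTranscriptLaw_transcript (γ c : ℝ) {ε : ℝ} (h0 : 0 ≤ ε) (h1 : ε ≤ 1 / 2)
    (π : Algorithm Ω X r) (S : ChannelStrategy Ω (comChannels d r)) (u : Ω) :
    IsTranscriptLaw
      (fun t h => outLaw ε fun z y =>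
        (S.channel t u h (γ • (π.iterate t u h : E d) - c • signVec z)).real {y})
      (fun v t h => (transcript (bernOracle X γ c ε v) π S u t).real {h}) where
  zero v h := by
    rw [Subsingleton.elim h Fin.elim0]
    simp [transcript, Measure.real]
  succ v t h y := by
    have : IsMarkovKernel (S.channel t u h) := S.channel_mem t u h
    rw [Measure.real, transcript_succ_snoc, ENNReal.toReal_mul, bernOracle_bind_apply,
      ENNReal.toReal_sum
        fun z _ => ENNReal.mul_ne_top ENNReal.ofReal_ne_top (measure_ne_top _ _)]
    simp only [ENNReal.toReal_mul, ENNReal.toReal_ofReal (bern_pos h0 h1 v _).le]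
    rfl
  nonneg t h v y := outLaw_nonneg h0 h1 (fun _ _ => measureReal_nonneg) v y
  sum_eq_one t h v := by
    have : IsMarkovKernel (S.channel t u h) := S.channel_mem t u h
    exact outLaw_sum (fun z => by simp) v

end Run

/-! ### From bit errors to the minmax error -/

/-- Lower bound on the minmax error over a ball, in terms of the parameters of the hard
instances. -/
theorem ofReal_le_minmaxError {T : ℕ} {B γ ρ ε δ c : ℝ} (hγ : 0 < γ) (hδ : 0 ≤ δ)
    (hδρ : δ * √(d : ℝ) ≤ ρ) (h0 : 0 ≤ ε) (h1 : ε ≤ 1 / 2) (hc : 0 ≤ c) (hcε : c * ε = γ * δ)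
    (hB : γ * ρ + c * √(d : ℝ) ≤ B) (hT : T * (16 * ε ^ 2 * min (d : ℝ) r) ≤ d / 4) :
    ENNReal.ofReal (γ / 2 * δ ^ 2 * (d / 6)) ≤
      minmaxError (Metric.closedBall (0 : E d) ρ)
        (strongConvexFamily (Metric.closedBall (0 : E d) ρ) B γ) T (comChannels d r) := by
  set X := Metric.closedBall (0 : E d) ρ with hX
  refine le_iInf fun Ω => le_iInf fun _ => le_iInf fun P => le_iInf fun π => le_iInf fun S => ?_
  set f : (Fin d → Bool) → E d → ℝ := fun v => quad γ (δ • signVec v) with hf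
  set O : (Fin d → Bool) → Oracle X := bernOracle X γ c ε with hO
  set L := ⨆ p ∈ strongConvexFamily X B γ, optError (P : Measure Ω) p.1 p.2 π S T with hL
  have hle : ∀ v, optError (P : Measure Ω) (f v) (O v) π S T ≤ L := fun v =>
    le_iSup₂_of_le (f := fun p (_ : p ∈ strongConvexFamily X B γ) =>
      optError (P : Measure Ω) p.1 p.2 π S T) (f v, O v)
      (quad_mem_strongConvexFamily hγ h0 h1 hc hcε hB v) le_rfl
  -- For each `u` separately, the signs of the coordinates of the output serve as the guess of `v`.
  have hpt : ∀ u, ENNReal.ofReal (2 ^ d * (γ / 2 * δ ^ 2 * (d / 6))) ≤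
      ∑ v, ∑ h, ENNReal.ofReal (f v (π.iterate T u h) - sInf (f v '' X))
        * transcript (O v) π S u T {h} := by
    intro u
    have hQ := isTranscriptLaw_transcript γ c h0 h1 π S u
    have hS := hQ.sum_errors_ge (η := 16 * ε ^ 2 * min (d : ℝ) r) (fun t h v => by
        have : IsMarkovKernel (S.channel t u h) := S.channel_mem t u h
        exact sum_one_sub_affinity_le h0 h1 (fun _ _ => measureReal_nonneg)
          (fun z => by simp) v) hT
      (fun h i => decide (0 ≤ (π.iterate T u h : E d) i))
    have hK : 0 ≤ γ / 2 * δ ^ 2 := by positivity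
    calc ENNReal.ofReal (2 ^ d * (γ / 2 * δ ^ 2 * (d / 6)))
        ≤ ENNReal.ofReal (∑ v, ∑ h, (f v (π.iterate T u h) - sInf (f v '' X))
            * (transcript (O v) π S u T).real {h}) := by
          refine ENNReal.ofReal_le_ofReal ?_
          have := mul_le_mul_of_nonneg_left hS hK
          refine le_trans (le_of_eq (by ring)) (this.trans ?_)
          simp only [Finset.mul_sum (s := (Finset.univ : Finset (Fin d → Bool)))]
          refine Finset.sum_le_sum fun v _ => ?_
          rw [Finset.mul_sum]
          refine Finset.sum_le_sum fun h _ => ?_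
          have := mul_le_mul_of_nonneg_right
            (quad_sub_sInf_ge hγ hδ hδρ v (π.iterate T u h : E d))
            (measureReal_nonneg (μ := transcript (O v) π S u T) (s := {h}))
          refine le_trans (le_of_eq ?_) this
          ring
      _ ≤ ∑ v, ∑ h, ENNReal.ofReal ((f v (π.iterate T u h) - sInf (f v '' X))
            * (transcript (O v) π S u T).real {h}) := by
          have hn : ∀ v h, 0 ≤ (f v (π.iterate T u h) - sInf (f v '' X))
              * (transcript (O v) π S u T).real {h} := fun v h =>
            mul_nonneg (le_trans (mul_nonneg hK (Finset.sum_nonneg fun i _ => by split_ifs <;> simp))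
              (quad_sub_sInf_ge hγ hδ hδρ v (π.iterate T u h : E d))) measureReal_nonneg
          rw [ENNReal.ofReal_sum_of_nonneg fun v _ => Finset.sum_nonneg fun h _ => hn v h]
          exact Finset.sum_le_sum fun v _ =>
            (ENNReal.ofReal_sum_of_nonneg fun h _ => hn v h).le
      _ ≤ _ := by
          refine Finset.sum_le_sum fun v _ => Finset.sum_le_sum fun h _ => ?_
          rw [ENNReal.ofReal_mul' measureReal_nonneg]
          gcongr
          exact ENNReal.ofReal_toReal_le
  have hsum : ∑ v, optError (P : Measure Ω) (f v) (O v) π S T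
      = ∫⁻ u, ∑ v, ∑ h, ENNReal.ofReal (f v (π.iterate T u h) - sInf (f v '' X))
        * transcript (O v) π S u T {h} ∂(P : Measure Ω) := by
    rw [lintegral_finsetSum]
    · simp only [optError, lintegral_fintype]
    · intro v _
      refine Finset.measurable_fun_sum _ fun h _ => Measurable.mul ?_ ?_
      · refine ENNReal.measurable_ofReal.comp (Measurable.sub_const ?_ _)
        have hit : Measurable fun u => (π.iterate T u h : E d) :=
          measurable_subtype_coe.comp ((π.measurable_iterate T).comp measurable_prodMk_right)
        have hcont : Continuous (f v) := by
          simp only [hf]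
          unfold quad
          fun_prop
        exact hcont.measurable.comp hit
      · exact measurable_transcript γ c ε v π S T h
  have hfin : ENNReal.ofReal (2 ^ d * (γ / 2 * δ ^ 2 * (d / 6))) ≤ 2 ^ d * L := by
    calc _ = ∫⁻ _u, ENNReal.ofReal (2 ^ d * (γ / 2 * δ ^ 2 * (d / 6))) ∂(P : Measure Ω) := by
          simp
      _ ≤ _ := lintegral_mono hpt
      _ = ∑ v, optError (P : Measure Ω) (f v) (O v) π S T := hsum.symm
      _ ≤ ∑ _v : Fin d → Bool, L := Finset.sum_le_sum fun v _ => hle v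
      _ = 2 ^ d * L := by simp
  rw [ENNReal.ofReal_mul (by positivity), ENNReal.ofReal_pow (by norm_num),
    ENNReal.ofReal_ofNat] at hfin
  exact (ENNReal.mul_le_mul_iff_right (by simp) (by simp)).1 hfin

end CommOpt

/-! ### Choice of the parameters -/

theorem theoremt :
    ∃ c₀ c₁ : ℝ, 0 < c₀ ∧ 0 < c₁ ∧
      ∀ (d r T : ℕ) (B γ D : ℝ), 1 ≤ d → 1 ≤ r → 0 < B → 0 < γ → 0 < D →
        D / 8 ≤ B / γ →
        c₀ * (B ^ 2 / (γ ^ 2 * D ^ 2)) * ((d : ℝ) / min (d : ℝ) (r : ℝ)) ≤ (T : ℝ) →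
        ENNReal.ofReal (c₁ * (B ^ 2 / (γ * (T : ℝ))) * ((d : ℝ) / min (d : ℝ) (r : ℝ))) ≤
          ⨆ X ∈ CommOpt.domains d D,
            CommOpt.minmaxError X (CommOpt.strongConvexFamily X B γ) T
              (CommOpt.comChannels d r) := by
  refine ⟨4, 1 / 3072, by norm_num, by norm_num, ?_⟩
  intro d r T B γ D hd hr hB hγ hD hBD hT
  have hd' : (0 : ℝ) < d := by exact_mod_cast hd
  have hr' : (0 : ℝ) < r := by exact_mod_cast hr
  have hm : 0 < min (d : ℝ) r := lt_min hd' hr'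
  set m := min (d : ℝ) r with hmdef
  have hTpos : (0 : ℝ) < T := lt_of_lt_of_le (by positivity) hT
  -- `R` is the squared radius, chosen so that the information budget `16 T ε² m` equals `d / 4`
  -- exactly when `ε = 2γρ/B`.
  set R := B ^ 2 * d / (256 * γ ^ 2 * T * m) with hR
  have hRpos : 0 < R := by positivity
  set ρ := √R with hρ
  have hρpos : 0 < ρ := Real.sqrt_pos.2 hRpos
  have hρsq : ρ ^ 2 = R := Real.sq_sqrt hRpos.le
  -- The lower bound on `T` with `c₀ = 4` enters here. With `γ D ≤ 8 B` it yields `γ ρ ≤ B / 4`,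
  -- hence `ε ≤ 1/2`.
  have hρD : ρ ≤ D / 32 := by
    rw [hρ, Real.sqrt_le_left (by positivity), hR, div_le_iff₀ (by positivity)]
    have e : 4 * (B ^ 2 / (γ ^ 2 * D ^ 2)) * (d / m) = 4 * B ^ 2 * d / (γ ^ 2 * D ^ 2 * m) := by
      field_simp
    rw [e, div_le_iff₀ (by positivity)] at hT
    linarith
  have hγρ : γ * ρ ≤ B / 4 := by
    rw [le_div_iff₀ hγ] at hBD
    nlinarith
  have hsd : 0 < √(d : ℝ) := Real.sqrt_pos.2 hd'
  have hsd2 : √(d : ℝ) ^ 2 = d := Real.sq_sqrt hd'.le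
  -- The noise has norm `c √d = B / 2` and the drift at most `B / 4`, within the bound `B`. The
  -- minimizers lie on the boundary sphere, as `δ √d = ρ`.
  have key := CommOpt.ofReal_le_minmaxError (d := d) (r := r) (T := T) (B := B) (γ := γ)
    (ρ := ρ) (ε := 2 * γ * ρ / B) (δ := ρ / √(d : ℝ)) (c := B / (2 * √(d : ℝ)))
    hγ (by positivity) (by rw [div_mul_cancel₀ _ hsd.ne']) (by positivity)
    (by rw [div_le_iff₀ hB]; linarith) (by positivity) (by field_simp)
    (by
      have : B / (2 * √(d : ℝ)) * √(d : ℝ) = B / 2 := by field_simp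
      rw [this]; linarith)
    (by
      rw [div_pow, mul_pow, hρsq, hR]
      refine le_of_eq ?_
      rw [← hmdef]
      field_simp
      norm_num)
  -- The error is `γ ρ² / 12`, and `12 * 256 = 3072` gives `c₁`.
  have hval : γ / 2 * (ρ / √(d : ℝ)) ^ 2 * (d / 6)
      = 1 / 3072 * (B ^ 2 / (γ * T)) * (d / m) := by
    rw [div_pow, hρsq, hsd2, hR]
    field_simp
    norm_num
  rw [hval] at key
  refine key.trans (le_iSup₂_of_le (f := fun X (_ : X ∈ CommOpt.domains d D) =>
    CommOpt.minmaxError X (CommOpt.strongConvexFamily X B γ) T (CommOpt.comChannels d r))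
    (Metric.closedBall 0 ρ) ⟨⟨0, by simpa using hρpos.le⟩, fun x hx y hy => ?_⟩ le_rfl)
  rw [mem_closedBall_zero_iff] at hx hy
  linarith [norm_sub_le x y]
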